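/- Let $J=\{1,\dots,n\}$ be a set of jobs; job $j$ has a volume $v_j>0$ and a resource requirement $r_j\in[0,1]$, and the volumes are pairwise distinct. A *schedule* is a family $R=(R_j)_{j\in J}$ of integrable functions $R_j:\mathbb R_{\ge0}\to[0,1]$. It is *feasible* if $\sum_{j}R_j(t)\le 1$ and $R_j(t)\le r_j$ for all $t\ge0$ and $j\in J$, and $\int_0^\infty R_j(t)\,dt\ge v_j$ for all $j\in J$. Put $C(R)=\sum_{j}C_j(R)$ with $C_j(R)=\sup\{t\ge 0: R_j(t)>0\}$, and $C^F(R)=\sum_{j}\int_0^\infty \frac{t\,R_j(t)}{v_j}\,dt$ (the total completion time and the total fractional completion time). Let $C^{F*}$ be the infimum of $C^F$ over all feasible schedules, i.e. the optimal value of the continuous linear program of minimizing $C^F(R)$ over feasible $R$. The *fractionality gap* of $R$ is $C(R)/C^{F*}$ (with $0/0=0$ if $n=0$). For $\alpha\in\mathbb R^J$ let $d_j(t)=\alpha_j-t/v_j$, and for $t\ge0$ write $i\succ_t j$ if $d_i(t)>d_j(t)$, or $d_i(t)=d_j(t)$ and $v_i>v_j$. The *line schedule* of $\alpha$ is the tuple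 $(R,\alpha,\beta,\gamma)$ given recursively by $$R_j(t)=\mathbf 1_{d_j(t)>0}\cdot\min\Bigl(r_j,\;1-\sum_{i\succ_t j}R_i(t)\Bigr),\qquad \beta_j(t)=\max(0,\,d_j(t)-\gamma(t)),$$ where, if $\sum_j R_j(t)=1$, $\gamma(t)=\max(0,d_j(t))$ for the smallest job $j$ with respect to $\succ_t$ with $R_j(t)>0$, and $\gamma(t)=0$ otherwise. A tuple $(R,\alpha,\beta,\gamma)$ is a *primal–dual pair* if $R$ is a feasible schedule; $(\alpha,\beta,\gamma)$ is feasible for the dual program, i.e. $\alpha_j,\beta_j(t),\gamma(t)\ge0$ and $\gamma(t)+\beta_j(t)\ge\alpha_j-t/v_j$; and the slackness conditions $$\alpha_j\Bigl(v_j-\int_0^\infty R_j(t)\,dt\Bigr)=0,\quad \beta_j(t)\,(r_j-R_j(t))=0,\quad \gamma(t)\Bigl(1-\sum_{i}R_i(t)\Bigr)=0,\quad R_j(t)\Bigl(\alpha_j-\frac{t}{v_j}-\beta_j(t)-\gamma(t)\Bigr)=0$$ hold, all for every $j\in J$ and $t\ge0$. **Proposition.** Suppose that the line schedule $(R^F,\alpha,\beta,\gamma)$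 of some $\alpha\in\mathbb R^J$ is a primal–dual pair. Then $C^F(R^F)=C^{F*}$ and $C(R^F)\le 2\,C^{F*}$; in particular, the fractionality gap of $R^F$ is at most $2$. -/

import Mathlib

open MeasureTheory Set
open scoped ENNReal

/-- A set of `n` jobs: job `j` has a processing volume `v j > 0` and a resource requirement
`r j ∈ [0, 1]`. -/
structure JobSet (n : ℕ) where
  v : Fin n → ℝ
  r : Fin n → ℝ
  v_pos : ∀ j, 0 < v j
  r_nonneg : ∀ j, 0 ≤ r j
  r_le_one : ∀ j, r j ≤ 1

/-- A schedule: integrable functions `R j` from the times `t ≥ 0` to `[0, 1]`.  (Times are real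
numbers; values at negative times play no role.) -/
structure IsSchedule {n : ℕ} (R : Fin n → ℝ → ℝ) : Prop where
  integrableOn : ∀ j, IntegrableOn (R j) (Ici 0)
  nonneg : ∀ j t, 0 ≤ t → 0 ≤ R j t
  le_one : ∀ j t, 0 ≤ t → R j t ≤ 1

/-- The completion time `C_j(R) = sup {t ≥ 0 | R_j(t) > 0}`, with values in `[0, ∞]`. -/
noncomputable def completionTime {n : ℕ} (R : Fin n → ℝ → ℝ) (j : Fin n) : ℝ≥0∞ :=
  ⨆ t ∈ {t : ℝ | 0 ≤ t ∧ 0 < R j t}, ENNReal.ofReal t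

/-- The total completion time `C(R)`. -/
noncomputable def totalCompletionTime {n : ℕ} (R : Fin n → ℝ → ℝ) : ℝ≥0∞ :=
  ∑ j, completionTime R j

namespace JobSet

variable {n : ℕ} (J : JobSet n)

/-- All job volumes are pairwise distinct. -/
def NonDegenerate : Prop := Function.Injective J.v

/-- `R` is a feasible schedule for `J`, that is, a feasible solution of the continuous linear
program. -/
structure IsFeasible (R : Fin n → ℝ → ℝ) : Prop extends IsSchedule R where
  le_requirement : ∀ j t, 0 ≤ t → R j t ≤ J.r j
  sum_le_one : ∀ t, 0 ≤ t → ∑ j, R j t ≤ 1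
  volume_le : ∀ j, J.v j ≤ ∫ t in Ici 0, R j t

/-- The total fractional completion time `C^F(R) = ∑_j ∫_0^∞ R_j(t) t / v_j dt`, with values in
`[0, ∞]`; this is the objective of the continuous linear program. -/
noncomputable def fractionalCompletionTime (R : Fin n → ℝ → ℝ) : ℝ≥0∞ :=
  ∑ j, ∫⁻ t in Ici 0, ENNReal.ofReal (R j t * t / J.v j)

/-- The optimal total fractional completion time `C^{F*}`. -/
noncomputable def optFractionalCompletionTime : ℝ≥0∞ :=
  ⨅ (R : Fin n → ℝ → ℝ) (_ : J.IsFeasible R), J.fractionalCompletionTime R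

/-- The fractionality gap `C(R) / C^{F*}`. -/
noncomputable def fractionalityGap (R : Fin n → ℝ → ℝ) : ℝ≥0∞ :=
  totalCompletionTime R / J.optFractionalCompletionTime

/-- Feasibility of `(α, β, γ)` for the dual of the continuous linear program. -/
structure IsDualFeasible (α : Fin n → ℝ) (β : Fin n → ℝ → ℝ) (γ : ℝ → ℝ) : Prop where
  alpha_nonneg : ∀ j, 0 ≤ α j
  beta_nonneg : ∀ j t, 0 ≤ t → 0 ≤ β j t
  gamma_nonneg : ∀ t, 0 ≤ t → 0 ≤ γ t
  constraint : ∀ j t, 0 ≤ t → α j - t / J.v j ≤ γ t + β j t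

/-- A primal-dual pair: a feasible primal and a feasible dual solution satisfying the continuous
slackness conditions. -/
structure IsPrimalDualPair (R : Fin n → ℝ → ℝ) (α : Fin n → ℝ) (β : Fin n → ℝ → ℝ)
    (γ : ℝ → ℝ) : Prop where
  primal : J.IsFeasible R
  dual : J.IsDualFeasible α β γ
  alpha_slack : ∀ j, α j * (J.v j - ∫ t in Ici 0, R j t) = 0
  beta_slack : ∀ j t, 0 ≤ t → β j t * (J.r j - R j t) = 0
  gamma_slack : ∀ t, 0 ≤ t → γ t * (1 - ∑ j, R j t) = 0
  resource_slack : ∀ j t, 0 ≤ t → R j t * (α j - t / J.v j - β j t - γ t) = 0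

/-- The dual line `d_j(t) = α_j - t / v_j`. -/
noncomputable def dualLine (α : Fin n → ℝ) (j : Fin n) (t : ℝ) : ℝ := α j - t / J.v j

/-- `J.Higher α t i j` is the priority relation `i ≻_t j`. -/
def Higher (α : Fin n → ℝ) (t : ℝ) (i j : Fin n) : Prop :=
  J.dualLine α j t < J.dualLine α i t ∨
    J.dualLine α i t = J.dualLine α j t ∧ J.v j < J.v i

theorem Higher.trans {J : JobSet n} {α : Fin n → ℝ} {t : ℝ} {i j k : Fin n}
    (h₁ : J.Higher α t i j) (h₂ : J.Higher α t j k) : J.Higher α t i k := by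
  unfold Higher at *
  grind

theorem Higher.irrefl {J : JobSet n} {α : Fin n → ℝ} {t : ℝ} {i : Fin n} :
    ¬ J.Higher α t i i := by
  simp [Higher]

open Classical in
/-- The resource assignment at time `t` of the line schedule of `α`: in decreasing order of
priority each job with a positive dual line receives as much of the remaining resource as it can
use, `R_j(t) = 1_{d_j(t) > 0} * min (r_j, 1 - ∑_{i ≻_t j} R_i(t))`. -/
noncomputable def lineAssign (α : Fin n → ℝ) (t : ℝ) (j : Fin n) : ℝ :=
  if 0 < J.dualLine α j t then
    min (J.r j) (1 - ∑ i : {i // J.Higher α t i j}, lineAssign α t i.1)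
  else 0
termination_by (Finset.univ.filter fun i => J.Higher α t i j).card
decreasing_by
  refine Finset.card_lt_card (Finset.ssubset_iff_of_subset ?_ |>.2 ⟨i.1, ?_, ?_⟩)
  · intro k hk
    simp only [Finset.mem_filter, Finset.mem_univ, true_and] at hk ⊢
    exact hk.trans i.2
  · simpa using i.2
  · simpa using Higher.irrefl

/-- The schedule of the line schedule of `α`. -/
noncomputable def lineSchedule (α : Fin n → ℝ) : Fin n → ℝ → ℝ :=
  fun j t => J.lineAssign α t j

open Classical in
theorem lineSchedule_eq (α : Fin n → ℝ) (j : Fin n) (t : ℝ) :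
    J.lineSchedule α j t =
      if 0 < J.dualLine α j t then
        min (J.r j) (1 - ∑ i with J.Higher α t i j, J.lineSchedule α i t)
      else 0 := by
  unfold lineSchedule
  rw [lineAssign]
  congr 3
  exact (Finset.sum_subtype _ (by simp) _).symm

/-- `j` is the smallest job according to `≻_t` with `R_j(t) > 0`. -/
def IsLowestServed (α : Fin n → ℝ) (t : ℝ) (j : Fin n) : Prop :=
  0 < J.lineSchedule α j t ∧
    ∀ i, 0 < J.lineSchedule α i t → i ≠ j → J.Higher α t i j

open Classical in
/-- The function `γ` of the line schedule of `α`: if the resource is exhausted at time `t`, then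
`γ(t) = max (0, d_j(t))` for the smallest job `j` according to `≻_t` with `R_j(t) > 0`; otherwise
`γ(t) = 0`. -/
noncomputable def lineGamma (α : Fin n → ℝ) (t : ℝ) : ℝ :=
  if h : ∑ j, J.lineSchedule α j t = 1 ∧ ∃ j, J.IsLowestServed α t j then
    max 0 (J.dualLine α h.2.choose t)
  else 0

theorem lineGamma_eq (α : Fin n → ℝ) (t : ℝ) (j : Fin n)
    (hsum : ∑ i, J.lineSchedule α i t = 1) (hj : J.IsLowestServed α t j) :
    J.lineGamma α t = max 0 (J.dualLine α j t) := by
  have h : ∑ i, J.lineSchedule α i t = 1 ∧ ∃ j, J.IsLowestServed α t j := ⟨hsum, j, hj⟩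
  have hk := h.2.choose_spec
  have hEq : h.2.choose = j := by
    by_contra hne
    exact Higher.irrefl ((hj.2 _ hk.1 hne).trans (hk.2 _ hj.1 (Ne.symm hne)))
  rw [lineGamma, dif_pos h, hEq]

/-- The functions `β_j(t) = max (0, d_j(t) - γ(t))` of the line schedule of `α`. -/
noncomputable def lineBeta (α : Fin n → ℝ) (j : Fin n) (t : ℝ) : ℝ :=
  max 0 (J.dualLine α j t - J.lineGamma α t)

end JobSet

/-!
The bounds hold for every primal-dual pair `(R, α, β, γ)`; the line schedule enters only as an
instance.

*Pointwise optimality.*  By slackness, at each time `t ≥ 0` the vector `R(t)` maximizes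
`∑ j, x j * d_j(t)` over all `0 ≤ x j ≤ r j` with `∑ j, x j ≤ 1`
(`IsPrimalDualPair.sum_mul_dualLine_le`).  Integrating this against another feasible schedule `S`
gives
`∑ j, α j * ∫ S j - C^F(S) ≤ ∑ j, α j * v j - C^F(R)` (`IsPrimalDualPair.lagrangian_le`).
As `α ≥ 0` and `∫ S j ≥ v j`, this yields `C^F(R) ≤ C^F(S)`, so `R` is optimal.

*The factor two.*  Slowing `R` down by a factor `c > 1`, that is, passing to
`S j t = R j (t / c)`, multiplies volumes by `c` and the fractional cost by `c ^ 2`.  The same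
inequality then reads `(c - 1) * ∑ j, α j * v j ≤ (c ^ 2 - 1) * C^F(R)`; dividing by `c - 1` and
letting `c → 1` gives `∑ j, α j * v j ≤ 2 * C^F(R)`
(`IsPrimalDualPair.sum_alpha_mul_volume_le`).  This is Euler's relation for the optimal cost,
which is homogeneous of degree two in the volumes and has gradient `α`.  Finally, a job that is
served at time `t` has a nonnegative dual line there, so `C_j(R) ≤ α j * v j`.
-/

namespace JobSet

variable {n : ℕ} {J : JobSet n} {R S : Fin n → ℝ → ℝ} {α : Fin n → ℝ} {β : Fin n → ℝ → ℝ}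
  {γ : ℝ → ℝ}

/-- The total fractional completion time as a real number.  It agrees with
`fractionalCompletionTime` when all first moments `∫ R j t * t` are finite; an infinite moment
contributes the junk value `0`. -/
noncomputable def fractionalCost (J : JobSet n) (R : Fin n → ℝ → ℝ) : ℝ :=
  ∑ j, ∫ t in Ici 0, R j t * t / J.v j

theorem fractionalCompletionTime_eq_ofReal (hR : IsSchedule R)
    (hm : ∀ j, IntegrableOn (fun t => R j t * t) (Ici 0)) :
    J.fractionalCompletionTime R = ENNReal.ofReal (J.fractionalCost R) := by
  have h0 : ∀ j t, 0 ≤ t → 0 ≤ R j t * t / J.v j := fun j t ht =>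
    div_nonneg (mul_nonneg (hR.nonneg j t ht) ht) (J.v_pos j).le
  rw [fractionalCost, ENNReal.ofReal_sum_of_nonneg fun j _ =>
    setIntegral_nonneg measurableSet_Ici (h0 j)]
  refine Finset.sum_congr rfl fun j _ => ?_
  exact (ofReal_integral_eq_lintegral_ofReal ((hm j).div_const _)
    (ae_restrict_of_forall_mem measurableSet_Ici (h0 j))).symm

/-- A schedule of finite total fractional completion time has finite first moments. -/
theorem integrableOn_mul_id_of_fractionalCompletionTime_ne_top (hR : IsSchedule R)
    (h : J.fractionalCompletionTime R ≠ ⊤) (j : Fin n) :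
    IntegrableOn (fun t => R j t * t) (Ici 0) := by
  have hm : AEStronglyMeasurable (fun t => R j t * t / J.v j) (volume.restrict (Ici 0)) := by
    simp_rw [div_eq_mul_inv]
    exact ((hR.integrableOn j).aestronglyMeasurable.mul
      measurable_id.aestronglyMeasurable).mul_const _
  have hfin := (ENNReal.sum_ne_top.1 h) j (Finset.mem_univ j)
  have hi : IntegrableOn (fun t => R j t * t / J.v j) (Ici 0) :=
    (lintegral_ofReal_ne_top_iff_integrable hm
      (ae_restrict_of_forall_mem measurableSet_Ici fun t ht =>
        div_nonneg (mul_nonneg (hR.nonneg j t ht) ht) (J.v_pos j).le)).1 hfin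
  refine (hi.mul_const (J.v j)).congr (Filter.Eventually.of_forall fun t => ?_)
  exact div_mul_cancel₀ _ (J.v_pos j).ne'

/-! ### Slowing down a schedule -/

theorem integral_comp_div_Ici (f : ℝ → ℝ) {c : ℝ} (hc : 0 < c) :
    ∫ t in Ici 0, f (t / c) = c * ∫ t in Ici 0, f t := by
  simp_rw [integral_Ici_eq_integral_Ioi, div_eq_mul_inv]
  rw [integral_comp_mul_right_Ioi _ _ (inv_pos.2 hc), zero_mul, inv_inv, smul_eq_mul]

theorem IsFeasible.comp_div (hR : J.IsFeasible R) {c : ℝ} (hc : 1 ≤ c) :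
    J.IsFeasible fun j t => R j (t / c) := by
  have hc0 : 0 < c := by linarith
  have hd : ∀ t : ℝ, 0 ≤ t → 0 ≤ t / c := fun t ht => div_nonneg ht hc0.le
  refine ⟨⟨fun j => ?_, fun j t ht => hR.nonneg j _ (hd t ht),
    fun j t ht => hR.le_one j _ (hd t ht)⟩, fun j t ht => hR.le_requirement j _ (hd t ht),
    fun t ht => hR.sum_le_one _ (hd t ht), fun j => ?_⟩
  · have h := hR.integrableOn j
    rw [integrableOn_Ici_iff_integrableOn_Ioi] at h ⊢
    simp_rw [div_eq_mul_inv]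
    rwa [integrableOn_Ioi_comp_mul_right_iff _ _ (inv_pos.2 hc0), zero_mul]
  · have h := hR.volume_le j
    rw [integral_comp_div_Ici _ hc0]
    nlinarith [J.v_pos j]

theorem integrableOn_comp_div_mul_id {f : ℝ → ℝ} (hf : IntegrableOn (fun t => f t * t) (Ici 0))
    {c : ℝ} (hc : 0 < c) : IntegrableOn (fun t => f (t / c) * t) (Ici 0) := by
  have h : IntegrableOn (fun t => f (t * c⁻¹) * (t * c⁻¹)) (Ici 0) := by
    rw [integrableOn_Ici_iff_integrableOn_Ioi] at hf ⊢
    rwa [integrableOn_Ioi_comp_mul_right_iff (fun t => f t * t) _ (inv_pos.2 hc), zero_mul]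
  refine (h.mul_const c).congr (Filter.Eventually.of_forall fun t => ?_)
  simp only [div_eq_mul_inv]
  field_simp

theorem fractionalCost_comp_div {c : ℝ} (hc : 0 < c) :
    J.fractionalCost (fun j t => R j (t / c)) = c ^ 2 * J.fractionalCost R := by
  rw [fractionalCost, fractionalCost, Finset.mul_sum]
  refine Finset.sum_congr rfl fun j _ => ?_
  have h := integral_comp_div_Ici (fun t => R j t * t / J.v j) hc
  rw [sq, mul_assoc, ← h, ← integral_const_mul]
  refine integral_congr_ae (Filter.Eventually.of_forall fun t => ?_)
  simp only
  field_simp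

/-! ### Consequences of slackness -/

namespace IsPrimalDualPair

theorem le_alpha_mul_volume (h : J.IsPrimalDualPair R α β γ) {j : Fin n} {t : ℝ} (ht : 0 ≤ t)
    (hpos : 0 < R j t) : t ≤ α j * J.v j := by
  have h1 := (mul_eq_zero.1 (h.resource_slack j t ht)).resolve_left hpos.ne'
  have h2 := h.dual.beta_nonneg j t ht
  have h3 := h.dual.gamma_nonneg t ht
  exact (div_le_iff₀ (J.v_pos j)).1 (by linarith)

theorem completionTime_le (h : J.IsPrimalDualPair R α β γ) (j : Fin n) :
    completionTime R j ≤ ENNReal.ofReal (α j * J.v j) :=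
  iSup₂_le fun _ ht => ENNReal.ofReal_le_ofReal (h.le_alpha_mul_volume ht.1 ht.2)

theorem integrableOn_mul_id (h : J.IsPrimalDualPair R α β γ) (j : Fin n) :
    IntegrableOn (fun t => R j t * t) (Ici 0) := by
  refine ((h.primal.integrableOn j).mul_const (α j * J.v j)).mono
    ((h.primal.integrableOn j).aestronglyMeasurable.mul measurable_id.aestronglyMeasurable)
    (ae_restrict_of_forall_mem measurableSet_Ici fun t ht => ?_)
  have ht : 0 ≤ t := ht
  rcases (h.primal.nonneg j t ht).eq_or_lt with h0 | h0
  · simp [← h0]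
  · have h1 := h.le_alpha_mul_volume ht h0
    rw [Real.norm_of_nonneg (mul_nonneg h0.le ht),
      Real.norm_of_nonneg (mul_nonneg h0.le (ht.trans h1))]
    exact mul_le_mul_of_nonneg_left h1 h0.le

/-- At each time the primal schedule maximizes the weighted sum of the dual lines among all
admissible resource assignments `x`.  Both sides are compared with the dual objective
`γ + ∑ j, r j * β j` at that time, which slackness identifies with the right-hand side. -/
theorem sum_mul_dualLine_le (h : J.IsPrimalDualPair R α β γ) {t : ℝ} (ht : 0 ≤ t) {x : Fin n → ℝ}
    (hx0 : ∀ j, 0 ≤ x j) (hxr : ∀ j, x j ≤ J.r j) (hx1 : ∑ j, x j ≤ 1) :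
    ∑ j, x j * J.dualLine α j t ≤ ∑ j, R j t * J.dualLine α j t := by
  have hγ := h.dual.gamma_nonneg t ht
  calc
    ∑ j, x j * J.dualLine α j t ≤ ∑ j, (x j * γ t + J.r j * β j t) := by
      refine Finset.sum_le_sum fun j _ => ?_
      have h1 : J.dualLine α j t ≤ γ t + β j t := h.dual.constraint j t ht
      have h2 := mul_le_mul_of_nonneg_left h1 (hx0 j)
      have h3 := mul_le_mul_of_nonneg_right (hxr j) (h.dual.beta_nonneg j t ht)
      linarith
    _ = (∑ j, x j) * γ t + ∑ j, J.r j * β j t := by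
      rw [Finset.sum_add_distrib, Finset.sum_mul]
    _ ≤ 1 * γ t + ∑ j, J.r j * β j t := by gcongr
    _ = (∑ j, R j t) * γ t + ∑ j, J.r j * β j t := by
      linarith [h.gamma_slack t ht]
    _ = ∑ j, R j t * J.dualLine α j t := by
      rw [Finset.sum_mul, ← Finset.sum_add_distrib]
      refine Finset.sum_congr rfl fun j _ => ?_
      have h1 := h.beta_slack j t ht
      have h2 := h.resource_slack j t ht
      rw [dualLine]
      linarith

end IsPrimalDualPair

theorem mul_dualLine_eq (x : ℝ) (j : Fin n) (t : ℝ) :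
    x * J.dualLine α j t = α j * x - x * t / J.v j := by
  rw [dualLine]
  ring

theorem integrableOn_mul_dualLine (hR : IsSchedule R)
    (hm : ∀ j, IntegrableOn (fun t => R j t * t) (Ici 0)) (j : Fin n) :
    IntegrableOn (fun t => R j t * J.dualLine α j t) (Ici 0) := by
  simp_rw [mul_dualLine_eq]
  exact ((hR.integrableOn j).const_mul _).sub ((hm j).div_const _)

theorem integral_sum_mul_dualLine (hR : IsSchedule R)
    (hm : ∀ j, IntegrableOn (fun t => R j t * t) (Ici 0)) :
    ∫ t in Ici 0, ∑ j, R j t * J.dualLine α j t =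
      ∑ j, α j * (∫ t in Ici 0, R j t) - J.fractionalCost R := by
  rw [integral_finsetSum _ fun j _ => integrableOn_mul_dualLine hR hm j, fractionalCost,
    ← Finset.sum_sub_distrib]
  refine Finset.sum_congr rfl fun j _ => ?_
  simp_rw [mul_dualLine_eq]
  rw [integral_sub ((hR.integrableOn j).const_mul _) ((hm j).div_const _), integral_const_mul]

namespace IsPrimalDualPair

/-- The primal schedule maximizes the Lagrangian of the volume constraints among the feasible
schedules with finite first moments. -/
theorem lagrangian_le (h : J.IsPrimalDualPair R α β γ) (hS : J.IsFeasible S)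
    (hm : ∀ j, IntegrableOn (fun t => S j t * t) (Ici 0)) :
    ∑ j, α j * (∫ t in Ici 0, S j t) - J.fractionalCost S ≤
      ∑ j, α j * J.v j - J.fractionalCost R := by
  have hv : ∑ j, α j * J.v j = ∑ j, α j * ∫ t in Ici 0, R j t :=
    Finset.sum_congr rfl fun j _ => by linarith [h.alpha_slack j]
  rw [hv, ← integral_sum_mul_dualLine hS.toIsSchedule hm,
    ← integral_sum_mul_dualLine h.primal.toIsSchedule h.integrableOn_mul_id]
  refine setIntegral_mono_on
    (integrable_finsetSum _ fun j _ => integrableOn_mul_dualLine hS.toIsSchedule hm j)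
    (integrable_finsetSum _ fun j _ =>
      integrableOn_mul_dualLine h.primal.toIsSchedule h.integrableOn_mul_id j)
    measurableSet_Ici fun t ht => ?_
  exact h.sum_mul_dualLine_le ht (fun j => hS.nonneg j t ht)
    (fun j => hS.le_requirement j t ht) (hS.sum_le_one t ht)

theorem fractionalCost_le (h : J.IsPrimalDualPair R α β γ) (hS : J.IsFeasible S)
    (hm : ∀ j, IntegrableOn (fun t => S j t * t) (Ici 0)) :
    J.fractionalCost R ≤ J.fractionalCost S := by
  have h1 := h.lagrangian_le hS hm
  have h2 : ∑ j, α j * J.v j ≤ ∑ j, α j * ∫ t in Ici 0, S j t :=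
    Finset.sum_le_sum fun j _ =>
      mul_le_mul_of_nonneg_left (hS.volume_le j) (h.dual.alpha_nonneg j)
  linarith

theorem fractionalCompletionTime_eq_opt (h : J.IsPrimalDualPair R α β γ) :
    J.fractionalCompletionTime R = J.optFractionalCompletionTime := by
  refine le_antisymm (le_iInf₂ fun S hS => ?_) (iInf₂_le R h.primal)
  rcases eq_or_ne (J.fractionalCompletionTime S) ⊤ with hT | hT
  · exact hT ▸ le_top
  have hm := integrableOn_mul_id_of_fractionalCompletionTime_ne_top hS.toIsSchedule hT
  rw [fractionalCompletionTime_eq_ofReal h.primal.toIsSchedule h.integrableOn_mul_id,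
    fractionalCompletionTime_eq_ofReal hS.toIsSchedule hm]
  exact ENNReal.ofReal_le_ofReal (h.fractionalCost_le hS hm)

/-- Half of Euler's relation `∑ j, α j * v j = 2 * C^F(R)`, obtained by comparing the primal
schedule with its slowed-down copies. -/
theorem sum_alpha_mul_volume_le (h : J.IsPrimalDualPair R α β γ) :
    ∑ j, α j * J.v j ≤ 2 * J.fractionalCost R := by
  have key : ∀ c : ℝ, 1 < c → ∑ j, α j * J.v j ≤ (c + 1) * J.fractionalCost R := by
    intro c hc
    have hc0 : 0 < c := by linarith
    have h1 := h.lagrangian_le (h.primal.comp_div hc.le)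
      fun j => integrableOn_comp_div_mul_id (h.integrableOn_mul_id j) hc0
    have h2 : ∑ j, α j * (∫ t in Ici 0, R j (t / c)) = c * ∑ j, α j * J.v j := by
      rw [Finset.mul_sum]
      refine Finset.sum_congr rfl fun j _ => ?_
      rw [integral_comp_div_Ici _ hc0]
      linear_combination (-c) * h.alpha_slack j
    rw [h2, fractionalCost_comp_div hc0] at h1
    exact le_of_mul_le_mul_left (by linarith) (sub_pos.2 hc)
  have hlim : Filter.Tendsto (fun c : ℝ => (c + 1) * J.fractionalCost R) (nhdsWithin 1 (Ioi 1))
      (nhds ((1 + 1) * J.fractionalCost R)) :=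
    (Continuous.tendsto (by fun_prop) 1).mono_left nhdsWithin_le_nhds
  have hle := ge_of_tendsto hlim (Filter.eventually_of_mem self_mem_nhdsWithin key)
  linarith

theorem totalCompletionTime_le (h : J.IsPrimalDualPair R α β γ) :
    totalCompletionTime R ≤ 2 * J.optFractionalCompletionTime := by
  rw [← h.fractionalCompletionTime_eq_opt,
    fractionalCompletionTime_eq_ofReal h.primal.toIsSchedule h.integrableOn_mul_id]
  calc
    totalCompletionTime R ≤ ∑ j, ENNReal.ofReal (α j * J.v j) :=
      Finset.sum_le_sum fun j _ => h.completionTime_le j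
    _ = ENNReal.ofReal (∑ j, α j * J.v j) :=
      (ENNReal.ofReal_sum_of_nonneg fun j _ =>
        mul_nonneg (h.dual.alpha_nonneg j) (J.v_pos j).le).symm
    _ ≤ ENNReal.ofReal (2 * J.fractionalCost R) :=
      ENNReal.ofReal_le_ofReal h.sum_alpha_mul_volume_le
    _ = 2 * ENNReal.ofReal (J.fractionalCost R) := by
      rw [ENNReal.ofReal_mul zero_le_two, ENNReal.ofReal_ofNat]

end IsPrimalDualPair

end JobSet

theorem mainTheorem6 {n : ℕ} (J : JobSet n) (hJ : J.NonDegenerate) (α : Fin n → ℝ)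
    (hα : J.IsPrimalDualPair (J.lineSchedule α) α (J.lineBeta α) (J.lineGamma α)) :
    J.fractionalCompletionTime (J.lineSchedule α) = J.optFractionalCompletionTime ∧
      totalCompletionTime (J.lineSchedule α) ≤ 2 * J.optFractionalCompletionTime ∧
      J.fractionalityGap (J.lineSchedule α) ≤ 2 :=
  ⟨hα.fractionalCompletionTime_eq_opt, hα.totalCompletionTime_le,
    ENNReal.div_le_of_le_mul hα.totalCompletionTime_le⟩
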